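/- Let $k,d\ge 1$ be integers. All graphs are finite, simple and undirected. For each $n$ let $P_n$ be the set of graphs on the vertex set $[n]$ that have maximum degree at most $d$ and do not contain the $k$-star (a center joined to $k$ other vertices) as a minor, and let $P=\bigcup_n P_n$. For graphs $G,G'$ on $[n]$ let $\mathrm{dist}(G,G')=|E(G)\,\triangle\,E(G')|$. A graph $G$ of maximum degree at most $d$ on $[n]$ is $\epsilon$-close to a set $S$ of such graphs if $\mathrm{dist}(G,G')\le\epsilon dn$ for some $G'\in S$, and $\epsilon$-far from $S$ otherwise; two sets of such graphs are $\epsilon$-close if every graph in each of them is $\epsilon$-close to the other. Then: (1) $P$ is monotone (closed under deleting edges) and hereditary (closed under deleting vertices). (2) $P$ is $1$-sided error strongly-testable in the $d$-bounded degree model: there is a function $Q:(0,1)\to\mathbb N$ such that for all $\epsilon\in(0,1)$ and all $n$ there is a randomized algorithm, depending on $\epsilon$ and $n$, that accesses a graph $G$ on $[n]$ of maximum degree at most $d$ by queries "vertex $v$", answered by the set of all neighbours of $v$; makes at most $Q(\epsilon)$ queries on every such input and in every run; accepts every $G\in P_n$ with probability $1$; and rejects every $G$ that is $\epsilon$-far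 from $P_n$ with probability at least $1/2$. (3) For $\epsilon\in(0,1)$ let $\mathcal H_\epsilon$ be the family of all graphs with at most $k/\epsilon+kd$ vertices that contain the $k$-star as a minor, and let $P_{\mathcal H_\epsilon,n}$ be the set of graphs on $[n]$ of maximum degree at most $d$ that have no subgraph isomorphic to a member of $\mathcal H_\epsilon$. Then for every $\epsilon\in(0,1)$ the number of vertices of every member of $\mathcal H_\epsilon$ is at most $\lfloor k/\epsilon+kd\rfloor$, a bound that does not depend on $n$, and for every $n$: (a) $P_n\subseteq P_{\mathcal H_\epsilon,n}$; (b) $P_{\mathcal H_\epsilon,n}$ is $\epsilon$-close to $P_n$; and, more precisely, (c) from every $G\in P_{\mathcal H_\epsilon,n}$ one can remove at most $\epsilon dn$ edges so that every connected component of the resulting graph has at most $k/\epsilon+kd-k$ vertices and the resulting graph is in $P_n$. -/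

import Mathlib

open scoped ENNReal

namespace BoundedDegree

/-! ### Minors and stars -/

/-- `H` is a minor of `G`: there are pairwise disjoint connected (in particular nonempty) branch
sets in `G`, one for each vertex of `H`, such that adjacent vertices of `H` have branch sets
joined by an edge of `G`. -/
def IsMinor {W V : Type*} (H : SimpleGraph W) (G : SimpleGraph V) : Prop :=
  ∃ B : W → Set V,
    (∀ w, (G.induce (B w)).Connected) ∧
    (∀ w w', w ≠ w' → Disjoint (B w) (B w')) ∧
    (∀ w w', H.Adj w w' → ∃ x ∈ B w, ∃ y ∈ B w', G.Adj x y)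

/-- The `k`-star: `k + 1` vertices, the center `0` being joined to each of the `k` others. -/
def kStar (k : ℕ) : SimpleGraph (Fin (k + 1)) := SimpleGraph.starGraph 0

theorem IsMinor.of_iso {W V V' : Type*} {H : SimpleGraph W} {G : SimpleGraph V}
    {G' : SimpleGraph V'} (φ : G ≃g G') (h : IsMinor H G) : IsMinor H G' := by
  obtain ⟨B, hc, hd, ha⟩ := h
  refine ⟨fun w => φ '' B w, fun w => ?_, fun w w' hne => ?_, fun w w' hw => ?_⟩
  · have e : G.induce (B w) ≃g G'.induce (φ '' B w) :=
      { toEquiv := φ.toEquiv.image (B w)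
        map_rel_iff' := by
          rintro ⟨a, ha⟩ ⟨b, hb⟩
          exact φ.map_adj_iff }
    exact e.connected_iff.1 (hc w)
  · exact (Set.disjoint_image_iff φ.injective).2 (hd w w' hne)
  · obtain ⟨x, hx, y, hy, hxy⟩ := ha w w' hw
    exact ⟨φ x, ⟨x, hx, rfl⟩, φ y, ⟨y, hy, rfl⟩, φ.map_adj_iff.2 hxy⟩

/-! ### The `d`-bounded degree model of undirected graphs, properties, distance -/

/-- All degrees of `G` are at most `d`. -/
def DegreeLE {n : ℕ} (d : ℕ) (G : SimpleGraph (Fin n)) : Prop :=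
  ∀ v, (G.neighborSet v).ncard ≤ d

theorem DegreeLE.of_iso {n d : ℕ} {G G' : SimpleGraph (Fin n)} (φ : G ≃g G')
    (h : DegreeLE d G) : DegreeLE d G' := by
  intro v
  have hv : G'.neighborSet v = φ '' G.neighborSet (φ.symm v) := by
    ext w
    simp only [SimpleGraph.mem_neighborSet, Set.mem_image]
    constructor
    · intro hw
      exact ⟨φ.symm w, φ.symm.map_adj_iff.2 hw, φ.apply_symm_apply w⟩
    · rintro ⟨u, hu, rfl⟩
      have := φ.map_adj_iff.2 hu
      rwa [φ.apply_symm_apply] at this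
  rw [hv, Set.ncard_image_of_injective _ φ.injective]
  exact h _

/-- A property of `d`-bounded degree graphs: for each `n`, a set of graphs with vertex set
`Fin n` and degrees at most `d`, closed under isomorphism. -/
structure GraphProperty (d : ℕ) where
  slice : (n : ℕ) → Set (SimpleGraph (Fin n))
  degreeLE : ∀ {n : ℕ} {G : SimpleGraph (Fin n)}, G ∈ slice n → DegreeLE d G
  iso : ∀ {n : ℕ} {G G' : SimpleGraph (Fin n)}, Nonempty (G ≃g G') → G ∈ slice n → G' ∈ slice n

/-- The property is closed under the deletion of an edge. -/
def GraphProperty.IsMonotone {d : ℕ} (P : GraphProperty d) : Prop :=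
  ∀ (n : ℕ), ∀ G ∈ P.slice n, ∀ e ∈ G.edgeSet, G.deleteEdges {e} ∈ P.slice n

/-- The property is closed under the deletion of a vertex; the vertices that remain are
relabelled by `Fin m`. -/
def GraphProperty.IsHereditary {d : ℕ} (P : GraphProperty d) : Prop :=
  ∀ (n : ℕ), ∀ G ∈ P.slice n, ∀ (v : Fin n) (m : ℕ) (G' : SimpleGraph (Fin m)),
    Nonempty (G' ≃g G.induce {v}ᶜ) → G' ∈ P.slice m

/-- The number of edges to be deleted from and inserted into `G` in order to make it `G'`. -/
noncomputable def dist {n : ℕ} (G G' : SimpleGraph (Fin n)) : ℕ :=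
  (symmDiff G.edgeSet G'.edgeSet).ncard

/-- `G` is `ε`-close to the set `S` of `d`-bounded degree graphs on `n` vertices. -/
def IsClose (d : ℕ) (ε : ℝ) {n : ℕ} (G : SimpleGraph (Fin n)) (S : Set (SimpleGraph (Fin n))) :
    Prop :=
  ∃ G' ∈ S, (dist G G' : ℝ) ≤ ε * d * n

/-- `G` is `ε`-far from the set `S` of `d`-bounded degree graphs on `n` vertices. -/
def IsFar (d : ℕ) (ε : ℝ) {n : ℕ} (G : SimpleGraph (Fin n)) (S : Set (SimpleGraph (Fin n))) :
    Prop :=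
  ∀ G' ∈ S, ε * d * n < (dist G G' : ℝ)

/-- Two sets of `d`-bounded degree graphs on `n` vertices are `ε`-close to each other. -/
def AreClose (d : ℕ) (ε : ℝ) {n : ℕ} (S S' : Set (SimpleGraph (Fin n))) : Prop :=
  (∀ G ∈ S, IsClose d ε G S') ∧ (∀ G ∈ S', IsClose d ε G S)

/-! ### Testers -/

/-- A deterministic adaptive algorithm with oracle access to a graph on `Fin n`: it stops with a
verdict (`true`: accept, `false`: reject), or it queries a vertex `v` and continues in a way that
depends on the answer, the set of neighbours of `v`. -/
inductive QueryTree (n : ℕ) : Type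
  | answer (b : Bool) : QueryTree n
  | query (v : Fin n) (next : Set (Fin n) → QueryTree n) : QueryTree n

namespace QueryTree

/-- The verdict on the input graph `G`. -/
def run {n : ℕ} (G : SimpleGraph (Fin n)) : QueryTree n → Bool
  | answer b => b
  | query v next => run G (next (G.neighborSet v))

/-- The number of queries made on the input graph `G`. -/
def queries {n : ℕ} (G : SimpleGraph (Fin n)) : QueryTree n → ℕ
  | answer _ => 0
  | query v next => queries G (next (G.neighborSet v)) + 1

end QueryTree

/-- A randomized query algorithm for graphs on `n` vertices: a probability distribution over
deterministic ones. -/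
abbrev Tester (n : ℕ) : Type := PMF (QueryTree n)

/-- The distribution of the verdict of the tester on `G`. -/
noncomputable def Tester.verdict {n : ℕ} (T : Tester n) (G : SimpleGraph (Fin n)) : PMF Bool :=
  PMF.map (QueryTree.run G) T

/-- `T` is a `1`-sided error `ε`-test for `P` on `n`-vertex graphs of degree at most `d`: graphs
in `P` are accepted with probability `1`, and graphs that are `ε`-far from `P` are rejected with
probability at least `1/2`. -/
def Tester.IsOneSidedTest {d n : ℕ} (T : Tester n) (ε : ℝ) (P : GraphProperty d) : Prop :=
  (∀ G ∈ P.slice n, T.verdict G true = 1) ∧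
  (∀ G : SimpleGraph (Fin n), DegreeLE d G → IsFar d ε G (P.slice n) →
    (1 / 2 : ℝ≥0∞) ≤ T.verdict G false)

/-- `T` makes at most `q` queries, on every input of degree at most `d` and in every run. -/
def Tester.QueriesLE {n : ℕ} (T : Tester n) (d q : ℕ) : Prop :=
  ∀ G : SimpleGraph (Fin n), DegreeLE d G → ∀ t ∈ T.support, t.queries G ≤ q

/-- `P` has, for all `ε ∈ (0, 1)` and all `n`, a `1`-sided error `ε`-test on `n`-vertex graphs
whose number of queries is bounded by a function of `ε` alone. -/
def GraphProperty.IsStronglyTestable {d : ℕ} (P : GraphProperty d) : Prop :=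
  ∃ Q : ℝ → ℕ, ∀ ε ∈ Set.Ioo (0 : ℝ) 1, ∀ n : ℕ,
    ∃ T : Tester n, T.IsOneSidedTest ε P ∧ T.QueriesLE d (Q ε)

/-! ### Forbidden families -/

/-- A set of finite graphs, given on the vertex sets `Fin m`. -/
abbrev GraphFamily : Type := (m : ℕ) → Set (SimpleGraph (Fin m))

/-- All members of the family have at most `r` vertices. -/
def GraphFamily.IsBoundedBy (F : GraphFamily) (r : ℕ) : Prop :=
  ∀ (m : ℕ), ∀ H ∈ F m, m ≤ r

/-- The property of the `d`-bounded degree graphs that have no subgraph isomorphic to a member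
of the family. -/
def freeProperty (d : ℕ) (F : GraphFamily) : GraphProperty d where
  slice n := {G | DegreeLE d G ∧ ∀ (m : ℕ), ∀ H ∈ F m, H.Free G}
  degreeLE h := h.1
  iso := by
    rintro n G G' ⟨φ⟩ ⟨hd, hF⟩
    exact ⟨hd.of_iso φ, fun m H hH hc => hF m H hH (hc.trans φ.symm.isContained)⟩

/-- The property of the `d`-bounded degree graphs that do not have the `k`-star as a minor. -/
def starMinorFree (k d : ℕ) : GraphProperty d where
  slice n := {G | DegreeLE d G ∧ ¬ IsMinor (kStar k) G}
  degreeLE h := h.1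
  iso := by
    rintro n G G' ⟨φ⟩ ⟨hd, hm⟩
    exact ⟨hd.of_iso φ, fun h => hm (h.of_iso φ.symm)⟩

/-- All graphs with at most `k / ε + k d` vertices that have the `k`-star as a minor. -/
def starFamily (k d : ℕ) (ε : ℝ) : GraphFamily :=
  fun m => {H | (m : ℝ) ≤ k / ε + k * d ∧ IsMinor (kStar k) H}

end BoundedDegree

namespace BoundedDegree

open SimpleGraph

/-! ### Star minors as connected sets with many outer neighbours -/

/-! A `k`-star minor is the same as a connected set with at least `k` outer neighbours: shrink each
leaf branch set to one vertex adjacent to the central one. So everything turns on `SmallBoundary k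
s`, which asks for fewer than `k` outer neighbours of connected sets of at most `s` vertices only.

Cutting (`exists_le_small_components`): while some component has more than `s` vertices, detach a
connected `s`-subset of it. This deletes at most `(k - 1) * d` edges and settles `s` vertices, so
the total is at most `ε * d * n` once `s ≥ (k - 1) / ε`. Afterwards every connected set has at most
`s` vertices, so no star minor is left. Members of the `starFamily`-free property satisfy
`SmallBoundary` for `s = pieceSize k d ε`, because a violating set together with `k` outer
neighbours would be a forbidden subgraph.

Testing: sample about `2 / ε` vertices, explore balls of radius `pieceSize k d (ε / 2)` and reject
if the edges seen have a star minor. Deleting all edges at the vertices whose balls reveal a minor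
leaves a graph with `SmallBoundary`, which is then cut with budget `ε / 2`. Hence a far graph has at
least `ε / 2 * n` such vertices, and the sample probably hits one. -/

/-- The vertices outside `S` that have a neighbour in `S`. -/
def outerBoundary {V : Type*} (G : SimpleGraph V) (S : Set V) : Set V :=
  {y | y ∉ S ∧ ∃ x ∈ S, G.Adj x y}

theorem connected_induce_image {V V' : Type*} {G : SimpleGraph V} {G' : SimpleGraph V'}
    {S : Set V} (hS : (G.induce S).Connected) (f : V → V')
    (hf : ∀ x ∈ S, ∀ y ∈ S, G.Adj x y → G'.Adj (f x) (f y)) :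
    (G'.induce (f '' S)).Connected := by
  let φ : G.induce S →g G'.induce (f '' S) :=
    { toFun := fun x => ⟨f x, x, x.2, rfl⟩
      map_rel' := fun {a b} h => hf a a.2 b b.2 h }
  refine hS.map φ ?_
  rintro ⟨_, x, hx, rfl⟩
  exact ⟨⟨x, hx⟩, rfl⟩

theorem connected_induce_of_adj {V : Type*} {G G' : SimpleGraph V} {S : Set V}
    (hS : (G.induce S).Connected) (h : ∀ x ∈ S, ∀ y ∈ S, G.Adj x y → G'.Adj x y) :
    (G'.induce S).Connected := by
  rw [← Set.image_id S]
  exact connected_induce_image hS id h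

theorem IsMinor.of_isContained {W V V' : Type*} {H : SimpleGraph W} {G : SimpleGraph V}
    {G' : SimpleGraph V'} (h : IsMinor H G) (hG : G ⊑ G') : IsMinor H G' := by
  obtain ⟨B, hc, hd, ha⟩ := h
  obtain ⟨f⟩ := hG
  refine ⟨fun w => f '' B w, fun w => connected_induce_image (hc w) f fun x _ y _ hxy =>
    f.toHom.map_adj hxy, fun w w' hne => (Set.disjoint_image_iff f.injective).2 (hd w w' hne),
    fun w w' hw => ?_⟩
  obtain ⟨x, hx, y, hy, hxy⟩ := ha w w' hw
  exact ⟨f x, ⟨x, hx, rfl⟩, f y, ⟨y, hy, rfl⟩, f.toHom.map_adj hxy⟩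

theorem IsMinor.mono {W V : Type*} {H : SimpleGraph W} {G G' : SimpleGraph V}
    (h : IsMinor H G) (hG : G ≤ G') : IsMinor H G' :=
  h.of_isContained ⟨Copy.ofLE G G' hG⟩

theorem isMinor_kStar_of_embedding {V : Type*} {k : ℕ} {G : SimpleGraph V} {S : Set V}
    (hS : (G.induce S).Connected) (f : Fin k → V) (hinj : Function.Injective f)
    (hf : ∀ i, f i ∈ outerBoundary G S) : IsMinor (kStar k) G := by
  refine ⟨Fin.cases S fun i => {f i}, ?_, ?_, ?_⟩
  · refine Fin.cases hS fun i => ?_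
    exact (Connected.of_subsingleton : (G.induce {f i}).Connected)
  · refine Fin.cases (Fin.cases (fun h => (h rfl).elim) fun i _ => ?_)
      fun i => Fin.cases (fun _ => ?_) fun j hij => ?_
    · exact Set.disjoint_singleton_right.2 (hf i).1
    · exact Set.disjoint_singleton_left.2 (hf i).1
    · exact Set.disjoint_singleton.2 fun h => hij (congrArg Fin.succ (hinj h))
  · have key : ∀ i, ∃ x ∈ S, G.Adj x (f i) := fun i => (hf i).2
    intro w w' hw
    rw [kStar, starGraph_adj] at hw
    obtain ⟨hne, rfl | rfl⟩ := hw
    · obtain ⟨i, rfl⟩ := Fin.exists_succ_eq.2 hne.symm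
      obtain ⟨x, hx, h⟩ := key i
      exact ⟨x, hx, f i, rfl, h⟩
    · obtain ⟨i, rfl⟩ := Fin.exists_succ_eq.2 hne
      obtain ⟨x, hx, h⟩ := key i
      exact ⟨f i, rfl, x, hx, h.symm⟩

theorem exists_embedding_of_le_ncard {V : Type*} [Finite V] {k : ℕ} {A : Set V}
    (h : k ≤ A.ncard) : ∃ f : Fin k → V, Function.Injective f ∧ ∀ i, f i ∈ A := by
  classical
  have := Fintype.ofFinite A
  obtain ⟨f⟩ : Nonempty (Fin k ↪ A) := by
    apply Function.Embedding.nonempty_of_card_le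
    rwa [Fintype.card_fin, ← Nat.card_eq_fintype_card, Nat.card_coe_set_eq]
  exact ⟨fun i => f i, Subtype.val_injective.comp f.injective, fun i => (f i).2⟩

theorem isMinor_kStar_iff {V : Type*} [Finite V] {k : ℕ} {G : SimpleGraph V} :
    IsMinor (kStar k) G ↔
      ∃ S : Set V, (G.induce S).Connected ∧ k ≤ (outerBoundary G S).ncard := by
  constructor
  · rintro ⟨B, hc, hd, ha⟩
    have h0 : ∀ i : Fin k, ∃ x ∈ B 0, ∃ y ∈ B i.succ, G.Adj x y := fun i =>
      ha 0 i.succ (starGraph_center_adj (Fin.succ_ne_zero i).symm)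
    choose x hx y hy hxy using h0
    have hinj : Function.Injective y := by
      intro i j hij
      by_contra hne
      exact Set.disjoint_left.1 (hd i.succ j.succ fun h => hne (Fin.succ_injective _ h))
        (hy i) (hij ▸ hy j)
    refine ⟨B 0, hc 0, ?_⟩
    have hsub : Set.range y ⊆ outerBoundary G (B 0) := by
      rintro _ ⟨i, rfl⟩
      exact ⟨fun h => Set.disjoint_left.1 (hd 0 i.succ (Fin.succ_ne_zero i).symm) h (hy i),
        x i, hx i, hxy i⟩
    calc k = (Set.range y).ncard := by
          rw [← Nat.card_coe_set_eq, Nat.card_range_of_injective hinj, Nat.card_fin]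
      _ ≤ _ := Set.ncard_le_ncard hsub
  · rintro ⟨S, hS, hk⟩
    obtain ⟨f, hinj, hf⟩ := exists_embedding_of_le_ncard hk
    exact isMinor_kStar_of_embedding hS f hinj hf

/-! ### Cutting a graph into small components -/

/-- Every connected set of at most `s` vertices has fewer than `k` outer neighbours. -/
def SmallBoundary {V : Type*} (k s : ℕ) (G : SimpleGraph V) : Prop :=
  ∀ S : Set V, (G.induce S).Connected → S.ncard ≤ s → (outerBoundary G S).ncard < k

theorem SmallBoundary.mono {V : Type*} [Finite V] {k s : ℕ} {G G' : SimpleGraph V}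
    (h : SmallBoundary k s G) (hle : G' ≤ G) : SmallBoundary k s G' := by
  intro S hS hs
  refine lt_of_le_of_lt (Set.ncard_le_ncard ?_)
    (h S (connected_induce_of_adj hS fun x _ y _ hxy => hle hxy) hs)
  rintro y ⟨hy, x, hx, hxy⟩
  exact ⟨hy, x, hx, hle hxy⟩

theorem subset_supp_of_connected_induce {V : Type*} {G : SimpleGraph V} {S : Set V}
    (hS : (G.induce S).Connected) {v : V} (hv : v ∈ S) :
    S ⊆ (G.connectedComponentMk v).supp := by
  intro x hx
  rw [ConnectedComponent.mem_supp_iff, ConnectedComponent.eq]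
  exact (hS.preconnected ⟨x, hx⟩ ⟨v, hv⟩).map (Embedding.induce S).toHom

theorem not_isMinor_kStar_of_smallBoundary {V : Type*} [Finite V] {k s : ℕ} {G : SimpleGraph V}
    (h : SmallBoundary k s G) (hc : ∀ c : G.ConnectedComponent, c.supp.ncard ≤ s) :
    ¬ IsMinor (kStar k) G := by
  rw [isMinor_kStar_iff]
  rintro ⟨S, hS, hk⟩
  obtain ⟨⟨v, hv⟩⟩ := hS.nonempty
  have := h S hS ((Set.ncard_le_ncard (subset_supp_of_connected_induce hS hv)).trans (hc _))
  omega

theorem exists_connected_subset_ncard_eq {V : Type*} [Finite V] (G : SimpleGraph V) (v : V)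
    (s : ℕ) (hs : s + 1 ≤ (G.connectedComponentMk v).supp.ncard) :
    ∃ S : Set V, v ∈ S ∧ (G.induce S).Connected ∧ S.ncard = s + 1 := by
  induction s with
  | zero => exact ⟨{v}, rfl, Connected.of_subsingleton, by simp⟩
  | succ s ih =>
    obtain ⟨S, hv, hS, hcard⟩ := ih (by omega)
    obtain ⟨w, hw, hwS⟩ := Set.exists_mem_notMem_of_ncard_lt_ncard
      (s := S) (t := (G.connectedComponentMk v).supp) (by omega)
    rw [ConnectedComponent.mem_supp_iff, ConnectedComponent.eq] at hw
    -- A walk from `v ∈ S` to `w ∉ S` must leave `S`; the first vertex outside extends `S` and keeps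
    -- it connected.
    obtain ⟨p⟩ := hw.symm
    obtain ⟨e, -, h1, h2⟩ := p.exists_boundary_dart S hv hwS
    refine ⟨S ∪ {e.snd}, Or.inl hv, ?_, ?_⟩
    · exact connected_induce_union hS.preconnected
        (Connected.of_subsingleton (G := G.induce {e.snd})).preconnected h1 rfl e.adj
    · rw [Set.union_singleton, Set.ncard_insert_of_notMem h2, hcard]

theorem ncard_le_mul_of_incident {V : Type*} [Finite V] {G : SimpleGraph V} {d : ℕ}
    (hd : ∀ v, (G.neighborSet v).ncard ≤ d) (A : Set V) {E : Set (Sym2 V)}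
    (hE : ∀ e ∈ E, e ∈ G.edgeSet ∧ ∃ v ∈ A, v ∈ e) : E.ncard ≤ A.ncard * d := by
  classical
  have := Fintype.ofFinite V
  have hsub : E ⊆ ⋃ v ∈ A.toFinset, G.incidenceSet v := by
    intro e he
    obtain ⟨h1, v, hv, hve⟩ := hE e he
    simp only [Set.mem_iUnion]
    exact ⟨v, by simpa using hv, h1, hve⟩
  calc E.ncard ≤ (⋃ v ∈ A.toFinset, G.incidenceSet v).ncard := Set.ncard_le_ncard hsub
    _ ≤ ∑ v ∈ A.toFinset, (G.incidenceSet v).ncard := Finset.set_ncard_biUnion_le _ _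
    _ ≤ ∑ v ∈ A.toFinset, d := by
        refine Finset.sum_le_sum fun v _ => ?_
        rw [← Nat.card_coe_set_eq, Nat.card_congr (G.incidenceSetEquivNeighborSet v),
          Nat.card_coe_set_eq]
        exact hd v
    _ = A.ncard * d := by rw [Finset.sum_const, smul_eq_mul, Set.ncard_eq_toFinset_card']

theorem supp_subset_of_no_crossing {V : Type*} {G : SimpleGraph V} {S : Set V}
    (h : ∀ x ∈ S, ∀ y ∉ S, ¬ G.Adj x y) {v : V} (hv : v ∈ S) :
    (G.connectedComponentMk v).supp ⊆ S := by
  intro w hw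
  by_contra hwS
  rw [ConnectedComponent.mem_supp_iff, ConnectedComponent.eq] at hw
  obtain ⟨p⟩ := hw.symm
  obtain ⟨e, -, h1, h2⟩ := p.exists_boundary_dart S hv hwS
  exact h _ h1 _ h2 e.adj

theorem supp_connectedComponentMk_mono {V : Type*} {G G' : SimpleGraph V} (h : G' ≤ G) (v : V) :
    (G'.connectedComponentMk v).supp ⊆ (G.connectedComponentMk v).supp := by
  intro w hw
  rw [ConnectedComponent.mem_supp_iff, ConnectedComponent.eq] at hw ⊢
  exact hw.mono h

/-- Here `b` bounds the number of vertices in oversized components, and each of them can pay `δ`.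
Detaching a set of `s` such vertices releases `δ * s`, which covers the deleted edges. -/
theorem exists_le_small_components {V : Type*} [Finite V] {k d s : ℕ} {δ : ℝ}
    (hs : 1 ≤ s) (hδ : ((k - 1 : ℕ) : ℝ) * d ≤ δ * s) (b : ℕ) :
    ∀ G : SimpleGraph V, (∀ v, (G.neighborSet v).ncard ≤ d) → SmallBoundary k s G →
      {v | s < (G.connectedComponentMk v).supp.ncard}.ncard ≤ b →
      ∃ G' ≤ G, ((G.edgeSet \ G'.edgeSet).ncard : ℝ) ≤ δ * b ∧
        ∀ c : G'.ConnectedComponent, c.supp.ncard ≤ s := by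
  have hδ0 : 0 ≤ δ := by
    by_contra hneg
    have h1 : (0 : ℝ) < s := by exact_mod_cast hs
    have h2 : (0 : ℝ) ≤ ((k - 1 : ℕ) : ℝ) * d := by positivity
    nlinarith
  induction b using Nat.strong_induction_on with
  | _ b ih =>
  intro G hdeg hG hb
  rcases Set.eq_empty_or_nonempty {v | s < (G.connectedComponentMk v).supp.ncard} with he | ⟨v, hv⟩
  · refine ⟨G, le_rfl, by simpa using by positivity, fun c => ?_⟩
    induction c using ConnectedComponent.ind with
    | _ v =>
    by_contra hv
    exact he.subset (show v ∈ {v | s < (G.connectedComponentMk v).supp.ncard} from not_le.1 hv)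
  · obtain ⟨S, hvS, hS, hcard⟩ := exists_connected_subset_ncard_eq G v (s - 1)
      (by simp only [Set.mem_ofPred_eq] at hv; omega)
    replace hcard : S.ncard = s := by omega
    let G₁ : SimpleGraph V :=
      { Adj := fun x y => G.Adj x y ∧ (x ∈ S ↔ y ∈ S)
        symm := ⟨fun x y h => ⟨h.1.symm, h.2.symm⟩⟩
        loopless := ⟨fun x h => h.1.ne rfl⟩ }
    have hle : G₁ ≤ G := fun x y h => h.1
    -- Cut edges are charged to their ends outside `S`, of which there are at most `k - 1`; charging
    -- the ends in `S` would cost a factor `s`.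
    have hcut : (G.edgeSet \ G₁.edgeSet).ncard ≤ (k - 1) * d := by
      refine (ncard_le_mul_of_incident hdeg (outerBoundary G S) ?_).trans
        (Nat.mul_le_mul_right _ (Nat.le_sub_one_of_lt (hG S hS hcard.le)))
      rintro e ⟨he, he'⟩
      refine ⟨he, ?_⟩
      induction e using Sym2.ind with
      | _ x y =>
      rw [mem_edgeSet] at he he'
      have hne : ¬ (x ∈ S ↔ y ∈ S) := fun h => he' ⟨he, h⟩
      by_cases hx : x ∈ S
      · exact ⟨y, ⟨fun hy => hne (by tauto), x, hx, he⟩, by simp⟩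
      · exact ⟨x, ⟨hx, y, by tauto, he.symm⟩, by simp⟩
    have hsub : {w | s < (G₁.connectedComponentMk w).supp.ncard} ⊆
        {w | s < (G.connectedComponentMk w).supp.ncard} \ S := by
      intro w hw
      refine ⟨lt_of_lt_of_le hw (Set.ncard_le_ncard (supp_connectedComponentMk_mono hle w)),
        fun hwS => ?_⟩
      have := Set.ncard_le_ncard (supp_subset_of_no_crossing (G := G₁)
        (fun x hx y hy h => hy (h.2.1 hx)) hwS)
      simp only [Set.mem_ofPred_eq] at hw
      omega
    have hSbig : S ⊆ {w | s < (G.connectedComponentMk w).supp.ncard} := by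
      intro w hw
      have := subset_supp_of_connected_induce hS hvS hw
      rw [ConnectedComponent.mem_supp_iff] at this
      simpa only [Set.mem_ofPred_eq, this] using hv
    have hb₁ := Set.ncard_le_ncard hsub
    rw [Set.ncard_sdiff hSbig, hcard] at hb₁
    have hsb := (Set.ncard_le_ncard hSbig).trans hb
    obtain ⟨G', hG', hcost, hcomp⟩ := ih (b - s) (by omega) G₁
      (fun v => (Set.ncard_le_ncard fun w hw => hle hw).trans (hdeg v)) (hG.mono hle) (by omega)
    refine ⟨G', hG'.trans hle, ?_, hcomp⟩
    have hun : G.edgeSet \ G'.edgeSet ⊆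
        (G.edgeSet \ G₁.edgeSet) ∪ (G₁.edgeSet \ G'.edgeSet) := by
      rintro e ⟨h1, h2⟩
      by_cases h3 : e ∈ G₁.edgeSet
      · exact Or.inr ⟨h3, h2⟩
      · exact Or.inl ⟨h1, h3⟩
    have h1 : ((G.edgeSet \ G'.edgeSet).ncard : ℝ) ≤
        (G.edgeSet \ G₁.edgeSet).ncard + (G₁.edgeSet \ G'.edgeSet).ncard := by
      exact_mod_cast (Set.ncard_le_ncard hun).trans (Set.ncard_union_le _ _)
    have h2 : ((G.edgeSet \ G₁.edgeSet).ncard : ℝ) ≤ ((k - 1 : ℕ) : ℝ) * d := by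
      exact_mod_cast hcut
    rw [Nat.cast_sub (by omega)] at hcost
    linarith


/-! ### Exploring balls by queries -/

/-- The edges of `G` that have an end in `A`. -/
def incidentGraph {V : Type*} (G : SimpleGraph V) (A : Set V) : SimpleGraph V where
  Adj x y := G.Adj x y ∧ (x ∈ A ∨ y ∈ A)
  symm := ⟨fun _ _ h => ⟨h.1.symm, h.2.symm⟩⟩
  loopless := ⟨fun _ h => h.1.ne rfl⟩

theorem incidentGraph_le {V : Type*} (G : SimpleGraph V) (A : Set V) : incidentGraph G A ≤ G :=
  fun _ _ h => h.1

theorem incidentGraph_mono {V : Type*} (G : SimpleGraph V) {A B : Set V} (h : A ⊆ B) :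
    incidentGraph G A ≤ incidentGraph G B :=
  fun _ _ hxy => ⟨hxy.1, hxy.2.imp (@h _) (@h _)⟩

/-- The closed neighbourhood of `A`. -/
def closedNeighborhood {V : Type*} (G : SimpleGraph V) (A : Set V) : Set V :=
  A ∪ ⋃ v ∈ A, G.neighborSet v

/-- The vertices at distance at most `r` from `A`. -/
def ballAround {V : Type*} (G : SimpleGraph V) : ℕ → Set V → Set V
  | 0, A => A
  | r + 1, A => ballAround G r (closedNeighborhood G A)

theorem ballAround_mono {V : Type*} (G : SimpleGraph V) (r : ℕ) {A B : Set V} (h : A ⊆ B) :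
    ballAround G r A ⊆ ballAround G r B := by
  induction r generalizing A B with
  | zero => exact h
  | succ r ih => exact ih (Set.union_subset_union h (Set.biUnion_subset_biUnion_left h))

theorem subset_ballAround {V : Type*} (G : SimpleGraph V) (r : ℕ) (A : Set V) :
    A ⊆ ballAround G r A := by
  induction r generalizing A with
  | zero => exact subset_rfl
  | succ r ih => exact Set.subset_union_left.trans (ih _)

theorem mem_ballAround_of_walk {V : Type*} {G : SimpleGraph V} {r : ℕ} {v x : V} {A : Set V}
    (p : G.Walk v x) (hv : v ∈ A) (hp : p.length ≤ r) : x ∈ ballAround G r A := by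
  induction p generalizing r A with
  | nil => exact subset_ballAround G r A hv
  | @cons u w x h p ih =>
    rw [Walk.length_cons] at hp
    obtain ⟨r, rfl⟩ : ∃ m, r = m + 1 := ⟨r - 1, by omega⟩
    exact ih (A := closedNeighborhood G A) (Or.inr (Set.mem_biUnion hv h)) (by omega)

theorem subset_ballAround_of_connected {V : Type*} [Finite V] {G : SimpleGraph V} {S : Set V}
    (hS : (G.induce S).Connected) {v : V} (hv : v ∈ S) {r : ℕ} (hr : S.ncard ≤ r) :
    S ⊆ ballAround G r {v} := by
  classical
  have := Fintype.ofFinite S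
  intro x hx
  obtain ⟨p, hp⟩ := hS.exists_isPath ⟨v, hv⟩ ⟨x, hx⟩
  have hlen := hp.length_lt
  rw [← Nat.card_eq_fintype_card, Nat.card_coe_set_eq] at hlen
  exact mem_ballAround_of_walk (p.map (Embedding.induce S).toHom) rfl
    ((Walk.length_map _ _).trans_le (by omega))

theorem closedNeighborhood_incidentGraph {V : Type*} (G : SimpleGraph V) (A : Set V) :
    closedNeighborhood (incidentGraph G A) A = closedNeighborhood G A := by
  unfold closedNeighborhood
  congr 1
  refine Set.iUnion₂_congr fun v hv => ?_
  ext w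
  exact ⟨fun h => h.1, fun h => ⟨h, Or.inl hv⟩⟩

theorem ncard_closedNeighborhood_le {V : Type*} [Finite V] {G : SimpleGraph V} {d : ℕ}
    (hd : ∀ v, (G.neighborSet v).ncard ≤ d) (A : Set V) :
    (closedNeighborhood G A).ncard ≤ (d + 1) * A.ncard := by
  classical
  have := Fintype.ofFinite V
  have h1 : (⋃ v ∈ A.toFinset, G.neighborSet v).ncard ≤ ∑ v ∈ A.toFinset, d :=
    (Finset.set_ncard_biUnion_le _ _).trans (Finset.sum_le_sum fun v _ => hd v)
  rw [Finset.sum_const, smul_eq_mul, ← Set.ncard_eq_toFinset_card'] at h1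
  simp only [Set.mem_toFinset] at h1
  calc (closedNeighborhood G A).ncard ≤ A.ncard + (⋃ v ∈ A, G.neighborSet v).ncard :=
        Set.ncard_union_le _ _
    _ ≤ (d + 1) * A.ncard := by linarith

/-- The graph with an edge from `a` to each other member of `N`. -/
def starTo {V : Type*} (a : V) (N : Set V) : SimpleGraph V :=
  fromRel fun x y => x = a ∧ y ∈ N

theorem incidentGraph_insert {V : Type*} (G : SimpleGraph V) (a : V) (A : Set V) :
    incidentGraph G (insert a A) = incidentGraph G A ⊔ starTo a (G.neighborSet a) := by
  ext x y
  simp only [incidentGraph, starTo, sup_adj, fromRel_adj, Set.mem_insert_iff, mem_neighborSet]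
  constructor
  · rintro ⟨h, (rfl | h') | (rfl | h')⟩
    · exact Or.inr ⟨h.ne, Or.inl ⟨rfl, h⟩⟩
    · exact Or.inl ⟨h, Or.inl h'⟩
    · exact Or.inr ⟨h.ne, Or.inr ⟨rfl, h.symm⟩⟩
    · exact Or.inl ⟨h, Or.inr h'⟩
  · rintro (⟨h, h'⟩ | ⟨-, ⟨rfl, h⟩ | ⟨rfl, h⟩⟩)
    · exact ⟨h, h'.imp Or.inr Or.inr⟩
    · exact ⟨h, Or.inl (Or.inl rfl)⟩
    · exact ⟨h.symm, Or.inr (Or.inl rfl)⟩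

/-- Querying all of `A` reveals exactly the edges that meet `A`. The continuation `next` lets the
rest of the algorithm depend on what was revealed, so that such trees can be chained. -/
theorem exists_queryTree_incidentGraph {n : ℕ} (A : Finset (Fin n)) :
    ∀ next : SimpleGraph (Fin n) → QueryTree n, ∃ t : QueryTree n, ∀ G,
      t.run G = (next (incidentGraph G A)).run G ∧
      t.queries G = A.card + (next (incidentGraph G A)).queries G := by
  classical
  induction A using Finset.induction_on with
  | empty =>
    intro next
    refine ⟨next ⊥, fun G => ?_⟩
    have : incidentGraph G (∅ : Set (Fin n)) = ⊥ := by
      ext x y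
      simp [incidentGraph]
    simp [this]
  | insert a A ha ih =>
    intro next
    -- For each possible answer `N` at `a`, the remaining tree has the star of `a` built into its
    -- continuation.
    choose t ht using fun N => ih fun K => next (K ⊔ starTo a N)
    refine ⟨.query a t, fun G => ?_⟩
    have h := ht (G.neighborSet a) G
    rw [← incidentGraph_insert] at h
    rw [QueryTree.run, QueryTree.queries, h.1, h.2, Finset.card_insert_of_notMem ha,
      Finset.coe_insert]
    exact ⟨rfl, by ring⟩

/-- There are `r + 1` rounds, each querying at most `(d + 1) ^ r * A.ncard` vertices; vertices may
be queried again in later rounds. The next round's set is computable because the edges at `A`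
already determine the closed neighbourhood of `A`. -/
theorem exists_queryTree_ballAround {n : ℕ} (r : ℕ) :
    ∀ (A : Set (Fin n)) (next : SimpleGraph (Fin n) → QueryTree n), ∃ t : QueryTree n, ∀ G,
      t.run G = (next (incidentGraph G (ballAround G r A))).run G ∧
      ∀ d, DegreeLE d G → t.queries G ≤ (r + 1) * (d + 1) ^ r * A.ncard +
        (next (incidentGraph G (ballAround G r A))).queries G := by
  classical
  induction r with
  | zero =>
    intro A next
    obtain ⟨t, ht⟩ := exists_queryTree_incidentGraph A.toFinset next
    rw [Set.coe_toFinset, ← Set.ncard_eq_toFinset_card'] at ht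
    exact ⟨t, fun G => ⟨(ht G).1, fun d _ => by simpa [ballAround] using (ht G).2.le⟩⟩
  | succ r ih =>
    intro A next
    choose t ht using fun K => ih (closedNeighborhood K A) next
    obtain ⟨t', ht'⟩ := exists_queryTree_incidentGraph A.toFinset t
    rw [Set.coe_toFinset, ← Set.ncard_eq_toFinset_card'] at ht'
    refine ⟨t', fun G => ?_⟩
    have h := ht (incidentGraph G A) G
    rw [closedNeighborhood_incidentGraph] at h
    refine ⟨(ht' G).1.trans h.1, fun d hd => ?_⟩
    rw [(ht' G).2]
    have h1 := h.2 d hd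
    have h2 := ncard_closedNeighborhood_le hd A
    have h3 := Nat.mul_le_mul_left ((r + 1) * (d + 1) ^ r) h2
    have h4 : A.ncard ≤ (d + 1) ^ (r + 1) * A.ncard :=
      Nat.le_mul_of_pos_left _ (by positivity)
    have h5 : (r + 1 + 1) * (d + 1) ^ (r + 1) * A.ncard =
        (d + 1) ^ (r + 1) * A.ncard + (r + 1) * (d + 1) ^ r * ((d + 1) * A.ncard) := by ring
    rw [ballAround, h5]
    omega

/-! ### Sampling -/

theorem half_le_uniform_of_hitting {n t : ℕ} [NeZero n] {δ : ℝ} (hδ : 1 ≤ δ * t)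
    {B : Set (Fin n)} (hB : δ * n ≤ B.ncard) (E : Set (Fin t → Fin n))
    (hE : ∀ f : Fin t → Fin n, (∃ i, f i ∈ B) → f ∈ E) :
    (1 / 2 : ℝ≥0∞) ≤ (PMF.uniformOfFintype (Fin t → Fin n)).toOuterMeasure E := by
  classical
  rw [PMF.toOuterMeasure_uniformOfFintype_apply]
  have hn : (0 : ℝ) < n := by exact_mod_cast Nat.pos_of_ne_zero (NeZero.ne n)
  -- A sample outside `E` misses `B` in every coordinate. The fraction of such samples is at most
  -- `exp (-δ * t) ≤ exp (-1) < 1 / 2`.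
  have hcompl : Fintype.card ↥(Eᶜ : Set (Fin t → Fin n)) ≤ (n - B.ncard) ^ t := by
    have hinj : Function.Injective
        (fun (f : ↥(Eᶜ : Set (Fin t → Fin n))) (i : Fin t) =>
          (⟨f.1 i, fun h => f.2 (hE _ ⟨i, h⟩)⟩ : ↥(Bᶜ : Set (Fin n)))) := by
      intro f g hfg
      ext i : 2
      exact congrArg Subtype.val (congrFun hfg i)
    refine (Fintype.card_le_of_injective _ hinj).trans (le_of_eq ?_)
    rw [Fintype.card_fun, Fintype.card_fin, Fintype.card_compl_set, Fintype.card_fin,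
      ← Nat.card_eq_fintype_card, Nat.card_coe_set_eq]
  have hBn : B.ncard ≤ n := by simpa using Set.ncard_le_card B
  have hpow : 2 * (n - B.ncard) ^ t ≤ n ^ t := by
    have h1 : ((n - B.ncard : ℕ) : ℝ) ≤ n * Real.exp (-δ) := by
      rw [Nat.cast_sub hBn]
      nlinarith [Real.one_sub_le_exp_neg δ]
    have h2 : ((n - B.ncard : ℕ) : ℝ) ^ t ≤ n ^ t * Real.exp (-1) := by
      calc ((n - B.ncard : ℕ) : ℝ) ^ t ≤ (n * Real.exp (-δ)) ^ t := by gcongr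
        _ = n ^ t * Real.exp (-(δ * t)) := by
          rw [mul_pow, ← Real.exp_nat_mul]
          congr 2
          ring
        _ ≤ n ^ t * Real.exp (-1) := by gcongr
    have h3 : Real.exp (-1) ≤ 1 / 2 := by
      rw [Real.exp_neg, one_div]
      exact inv_anti₀ two_pos (by linarith [Real.exp_one_gt_d9])
    have h4 : (0 : ℝ) < n ^ t := by positivity
    have h5 : (2 : ℝ) * ((n - B.ncard : ℕ) : ℝ) ^ t ≤ n ^ t := by nlinarith
    exact_mod_cast h5
  rw [Fintype.card_compl_set] at hcompl
  have hcard : Fintype.card (Fin t → Fin n) = n ^ t := by simp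
  have hfin : n ^ t ≤ 2 * Fintype.card E := by
    rw [hcard] at hcompl
    omega
  rw [hcard, ENNReal.le_div_iff_mul_le (Or.inl (by simp [NeZero.ne n])) (Or.inl (by simp)),
    one_div, mul_comm, ← div_eq_mul_inv, ENNReal.div_le_iff (by simp) (by simp), mul_comm]
  exact_mod_cast hfin

/-! ### The tester -/

/-- Monotonicity of `Pr` is used twice: what is seen is a subgraph of `G`, so rejection is never
wrong, and it contains the ball of each sampled vertex, so one hit suffices. -/
theorem exists_ball_tester {n : ℕ} [NeZero n] (Pr : SimpleGraph (Fin n) → Prop)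
    (hPr : ∀ K K', K ≤ K' → Pr K → Pr K') (r t d : ℕ) :
    ∃ T : Tester n, (∀ G, ¬ Pr G → T.verdict G true = 1) ∧
      T.QueriesLE d ((r + 1) * (d + 1) ^ r * t) ∧
      ∀ (G : SimpleGraph (Fin n)) (δ : ℝ), 1 ≤ δ * t →
        δ * n ≤ {v | Pr (incidentGraph G (ballAround G r {v}))}.ncard →
        (1 / 2 : ℝ≥0∞) ≤ T.verdict G false := by
  classical
  choose tree htree using fun f : Fin t → Fin n => exists_queryTree_ballAround r (Set.range f)
    fun K => .answer (decide ¬ Pr K)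
  have hrun : ∀ f G, (tree f).run G =
      decide ¬ Pr (incidentGraph G (ballAround G r (Set.range f))) := fun f G => (htree f G).1
  refine ⟨(PMF.uniformOfFintype (Fin t → Fin n)).map tree, fun G hG => ?_, ?_, ?_⟩
  · have : QueryTree.run G ∘ tree = Function.const _ true := by
      funext f
      simpa [hrun] using fun h => hG (hPr _ _ (incidentGraph_le G _) h)
    rw [Tester.verdict, PMF.map_comp, this, PMF.map_const]
    simp
  · intro G hd q hq
    rw [PMF.mem_support_map_iff] at hq
    obtain ⟨f, -, rfl⟩ := hq
    refine ((htree f G).2 d hd).trans ?_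
    rw [QueryTree.queries, add_zero]
    refine Nat.mul_le_mul_left _ ?_
    rw [← Set.image_univ]
    refine (Set.ncard_image_le Set.finite_univ).trans ?_
    simp
  · intro G δ hδ hB
    rw [Tester.verdict, PMF.map_comp, ← PMF.toOuterMeasure_apply_singleton,
      PMF.toOuterMeasure_map_apply]
    refine half_le_uniform_of_hitting hδ hB _ ?_
    rintro f ⟨i, hi⟩
    simp only [Set.mem_preimage, Function.comp_apply, hrun, Set.mem_singleton_iff,
      decide_eq_false_iff_not, not_not]
    exact hPr _ _ (incidentGraph_mono G (ballAround_mono G r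
      (Set.singleton_subset_iff.2 ⟨i, rfl⟩))) hi


/-! ### Graphs without the `k`-star as a minor -/

/-- The number of vertices of the pieces into which graphs are cut. -/
noncomputable def pieceSize (k d : ℕ) (ε : ℝ) : ℕ := ⌊(k : ℝ) / ε + k * d - k⌋₊

section PieceSize

variable {k d : ℕ} {ε : ℝ}

theorem one_lt_pieceSize_bound (hk : 1 ≤ k) (hd : 1 ≤ d) (hε : ε ∈ Set.Ioo (0 : ℝ) 1) :
    1 < (k : ℝ) / ε + k * d - k := by
  have h1 : (1 : ℝ) ≤ k := by exact_mod_cast hk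
  have h2 : (1 : ℝ) ≤ d := by exact_mod_cast hd
  have h3 : (k : ℝ) < k / ε := by
    rw [lt_div_iff₀ hε.1]
    nlinarith [hε.2]
  nlinarith

theorem one_le_pieceSize (hk : 1 ≤ k) (hd : 1 ≤ d) (hε : ε ∈ Set.Ioo (0 : ℝ) 1) :
    1 ≤ pieceSize k d ε :=
  Nat.le_floor (by simpa using (one_lt_pieceSize_bound hk hd hε).le)

theorem pieceSize_le (hk : 1 ≤ k) (hd : 1 ≤ d) (hε : ε ∈ Set.Ioo (0 : ℝ) 1) :
    (pieceSize k d ε : ℝ) ≤ (k : ℝ) / ε + k * d - k :=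
  Nat.floor_le (by linarith [one_lt_pieceSize_bound hk hd hε])

/-- As `d ≥ 1`, the floor exceeds `k / ε - 1`; multiplying by `ε < 1` leaves more than `k - 1`. -/
theorem mul_le_mul_pieceSize (hk : 1 ≤ k) (hd : 1 ≤ d) (hε : ε ∈ Set.Ioo (0 : ℝ) 1) :
    ((k - 1 : ℕ) : ℝ) * d ≤ ε * d * pieceSize k d ε := by
  have h1 : (1 : ℝ) ≤ k := by exact_mod_cast hk
  have h2 : (1 : ℝ) ≤ d := by exact_mod_cast hd
  have h3 : (k : ℝ) / ε + k * d - k < pieceSize k d ε + 1 := Nat.lt_floor_add_one _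
  have h4 : (k : ℝ) / ε < pieceSize k d ε + 1 := by nlinarith
  rw [div_lt_iff₀ hε.1] at h4
  have h5 : (k : ℝ) - 1 ≤ ε * pieceSize k d ε := by nlinarith [hε.2]
  rw [Nat.cast_sub hk, Nat.cast_one]
  nlinarith

end PieceSize

theorem DegreeLE.mono {n d : ℕ} {G G' : SimpleGraph (Fin n)} (h : DegreeLE d G) (hle : G' ≤ G) :
    DegreeLE d G' :=
  fun v => (Set.ncard_le_ncard fun _ hw => hle hw).trans (h v)

theorem dist_eq_of_le {n : ℕ} {G G' : SimpleGraph (Fin n)} (h : G' ≤ G) :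
    dist G G' = (G.edgeSet \ G'.edgeSet).ncard := by
  rw [dist, symmDiff_of_ge (edgeSet_subset_edgeSet.2 h)]

theorem exists_le_mem_starMinorFree {k d n : ℕ} (hk : 1 ≤ k) (hd : 1 ≤ d) {ε : ℝ}
    (hε : ε ∈ Set.Ioo (0 : ℝ) 1) {G : SimpleGraph (Fin n)} (hdeg : DegreeLE d G)
    (hG : SmallBoundary k (pieceSize k d ε) G) :
    ∃ G' ≤ G, ((G.edgeSet \ G'.edgeSet).ncard : ℝ) ≤ ε * d * n ∧
      (∀ c : G'.ConnectedComponent, c.supp.ncard ≤ pieceSize k d ε) ∧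
      G' ∈ (starMinorFree k d).slice n := by
  obtain ⟨G', hle, hcost, hc⟩ := exists_le_small_components (one_le_pieceSize hk hd hε)
    (mul_le_mul_pieceSize hk hd hε) n G hdeg hG
    ((Set.ncard_le_card _).trans_eq (Nat.card_fin n))
  exact ⟨G', hle, hcost, hc, hdeg.mono hle, not_isMinor_kStar_of_smallBoundary (hG.mono hle) hc⟩

theorem smallBoundary_of_mem_freeProperty {k d n : ℕ} (hk : 1 ≤ k) (hd : 1 ≤ d) {ε : ℝ}
    (hε : ε ∈ Set.Ioo (0 : ℝ) 1) {G : SimpleGraph (Fin n)}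
    (hG : G ∈ (freeProperty d (starFamily k d ε)).slice n) :
    SmallBoundary k (pieceSize k d ε) G := by
  classical
  intro S hS hs
  by_contra! hlt
  obtain ⟨f, hinj, hf⟩ := exists_embedding_of_le_ncard hlt
  -- Only `k` of the outer neighbours are kept; the `- k` in `pieceSize` makes room for them below
  -- the bound of `starFamily`.
  let T : Set (Fin n) := S ∪ Set.range f
  have hST : S ⊆ T := Set.subset_union_left
  have hfT : ∀ i, f i ∈ T := fun i => Or.inr ⟨i, rfl⟩
  have hT : T.ncard ≤ pieceSize k d ε + k := by
    refine (Set.ncard_union_le _ _).trans (add_le_add hs ?_)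
    rw [← Nat.card_coe_set_eq, Nat.card_range_of_injective hinj, Nat.card_fin]
  have hminor : IsMinor (kStar k) (G.induce T) := by
    refine isMinor_kStar_of_embedding (S := Subtype.val ⁻¹' S) ?_ (fun i => ⟨f i, hfT i⟩)
      (fun i j h => hinj (congrArg Subtype.val h)) fun i => ⟨(hf i).1, ?_⟩
    · let φ : G.induce S →g (G.induce T).induce (Subtype.val ⁻¹' S) :=
        { toFun := fun x => ⟨⟨x, hST x.2⟩, x.2⟩
          map_rel' := fun h => h }
      exact hS.map φ fun x => ⟨⟨x.1.1, x.2⟩, rfl⟩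
    · obtain ⟨x, hx, hxf⟩ := (hf i).2
      exact ⟨⟨x, hST hx⟩, hx, hxf⟩
  have hcard : Fintype.card T = T.ncard := by
    rw [← Nat.card_eq_fintype_card, Nat.card_coe_set_eq]
  let φ := (G.induce T).overFinIso hcard
  refine hG.2 T.ncard ((G.induce T).overFin hcard) ⟨?_, hminor.of_iso φ⟩
    (φ.symm.isContained.trans ⟨(Embedding.induce T).toCopy⟩)
  have h1 := pieceSize_le hk hd hε
  have h2 : (T.ncard : ℝ) ≤ pieceSize k d ε + k := by exact_mod_cast hT
  linarith

/-- A violating `S` has an edge of `G₁` leaving it, as `k ≥ 1`, and the end `v ∈ S` of this edge is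
good. But `S` lies in the `s`-ball around `v`, whose incident edges include all edges at `S`, so
that ball would already reveal the minor. -/
theorem smallBoundary_of_delete_bad {V : Type*} [Finite V] {k s : ℕ} (hk : 1 ≤ k)
    {G G₁ : SimpleGraph V}
    (hG₁ : ∀ x y, G₁.Adj x y → G.Adj x y ∧
      ¬ IsMinor (kStar k) (incidentGraph G (ballAround G s {x}))) :
    SmallBoundary k s G₁ := by
  intro S hS hs
  by_contra! hlt
  obtain ⟨y, -, v, hv, hvy⟩ := Set.nonempty_of_ncard_ne_zero (s := outerBoundary G₁ S) (by omega)
  have hSG : (G.induce S).Connected :=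
    connected_induce_of_adj hS fun x _ y _ h => (hG₁ x y h).1
  have hball := subset_ballAround_of_connected hSG hv hs
  refine (hG₁ v y hvy).2 (isMinor_kStar_iff.2 ⟨S, ?_, hlt.trans (Set.ncard_le_ncard ?_)⟩)
  · exact connected_induce_of_adj hS fun x hx y _ h => ⟨(hG₁ x y h).1, Or.inl (hball hx)⟩
  · rintro w ⟨hw, x, hx, hxw⟩
    exact ⟨hw, x, hx, (hG₁ x w hxw).1, Or.inl (hball hx)⟩

theorem mul_le_ncard_bad_of_isFar {k d n : ℕ} (hk : 1 ≤ k) (hd : 1 ≤ d) {ε : ℝ}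
    (hε : ε ∈ Set.Ioo (0 : ℝ) 1) {G : SimpleGraph (Fin n)} (hdeg : DegreeLE d G)
    (hfar : IsFar d ε G ((starMinorFree k d).slice n)) :
    ε / 2 * n ≤ {v | IsMinor (kStar k)
      (incidentGraph G (ballAround G (pieceSize k d (ε / 2)) {v}))}.ncard := by
  -- Half of the budget pays for cutting into pieces, so being far forces the edges at `B` to use up
  -- the other half.
  have hε' : ε / 2 ∈ Set.Ioo (0 : ℝ) 1 := ⟨by linarith [hε.1], by linarith [hε.2]⟩
  set B := {v | IsMinor (kStar k)
      (incidentGraph G (ballAround G (pieceSize k d (ε / 2)) {v}))} with hB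
  let G₁ : SimpleGraph (Fin n) :=
    { Adj := fun x y => G.Adj x y ∧ x ∉ B ∧ y ∉ B
      symm := ⟨fun x y h => ⟨h.1.symm, h.2.2, h.2.1⟩⟩
      loopless := ⟨fun x h => h.1.ne rfl⟩ }
  have hle : G₁ ≤ G := fun x y h => h.1
  have hcut : (G.edgeSet \ G₁.edgeSet).ncard ≤ B.ncard * d := by
    refine ncard_le_mul_of_incident hdeg B ?_
    rintro e ⟨he, he'⟩
    refine ⟨he, ?_⟩
    induction e using Sym2.ind with
    | _ x y =>
    rw [mem_edgeSet] at he he'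
    by_cases hx : x ∈ B
    · exact ⟨x, hx, by simp⟩
    · exact ⟨y, by_contra fun hy => he' ⟨he, hx, hy⟩, by simp⟩
  obtain ⟨G', hG', hcost, -, hmem⟩ := exists_le_mem_starMinorFree hk hd hε' (hdeg.mono hle)
    (smallBoundary_of_delete_bad hk (G := G) fun x y h => ⟨h.1, h.2.1⟩)
  have hlt := hfar G' hmem
  rw [dist_eq_of_le (hG'.trans hle)] at hlt
  have hun : G.edgeSet \ G'.edgeSet ⊆
      (G.edgeSet \ G₁.edgeSet) ∪ (G₁.edgeSet \ G'.edgeSet) := by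
    rintro e ⟨h1, h2⟩
    by_cases h3 : e ∈ G₁.edgeSet
    · exact Or.inr ⟨h3, h2⟩
    · exact Or.inl ⟨h1, h3⟩
  have h1 : ((G.edgeSet \ G'.edgeSet).ncard : ℝ) ≤
      (G.edgeSet \ G₁.edgeSet).ncard + (G₁.edgeSet \ G'.edgeSet).ncard := by
    exact_mod_cast (Set.ncard_le_ncard hun).trans (Set.ncard_union_le _ _)
  have h2 : ((G.edgeSet \ G₁.edgeSet).ncard : ℝ) ≤ B.ncard * d := by exact_mod_cast hcut
  have hd0 : (0 : ℝ) < d := by exact_mod_cast hd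
  have h3 : ε / 2 * n * d ≤ B.ncard * d := by linarith
  exact le_of_mul_le_mul_right h3 hd0

theorem starMinorFree_isMonotone (k d : ℕ) : (starMinorFree k d).IsMonotone := by
  intro n G hG e _
  exact ⟨hG.1.mono (deleteEdges_le _), fun h => hG.2 (h.mono (deleteEdges_le _))⟩

theorem starMinorFree_isHereditary (k d : ℕ) : (starMinorFree k d).IsHereditary := by
  rintro n G hG v m G' ⟨φ⟩
  refine ⟨fun w => ?_, fun h =>
    hG.2 (h.of_isContained (φ.isContained.trans ⟨(Embedding.induce {v}ᶜ).toCopy⟩))⟩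
  have hinj : Function.Injective fun x => (φ x : Fin n) :=
    Subtype.val_injective.comp φ.injective
  rw [← Set.ncard_image_of_injective _ hinj]
  refine (Set.ncard_le_ncard ?_).trans (hG.1 (φ w))
  rintro _ ⟨x, hx, rfl⟩
  exact φ.map_adj_iff.2 hx

theorem starMinorFree_isStronglyTestable {k d : ℕ} (hk : 1 ≤ k) (hd : 1 ≤ d) :
    (starMinorFree k d).IsStronglyTestable := by
  refine ⟨fun ε => (pieceSize k d (ε / 2) + 1) * (d + 1) ^ pieceSize k d (ε / 2) * ⌈2 / ε⌉₊,
    fun ε hε n => ?_⟩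
  rcases Nat.eq_zero_or_pos n with rfl | hn
  -- With no vertices there is nothing to sample; the empty graph has the property, since branch
  -- sets are nonempty, so always accepting is correct.
  · refine ⟨PMF.pure (.answer true), ⟨fun G _ => ?_, fun G hG hfar => ?_⟩, fun G _ t ht => ?_⟩
    · simp [Tester.verdict, PMF.pure_map, QueryTree.run]
    · have hmem : G ∈ (starMinorFree k d).slice 0 := by
        refine ⟨hG, ?_⟩
        rintro ⟨B, hc, -⟩
        obtain ⟨x⟩ := (hc 0).nonempty
        exact x.1.elim0
      have := hfar G hmem
      simp [dist] at this
    · rw [PMF.support_pure, Set.mem_singleton_iff] at ht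
      simp [ht, QueryTree.queries]
  · have : NeZero n := ⟨hn.ne'⟩
    obtain ⟨T, hacc, hq, hrej⟩ := exists_ball_tester (n := n) (fun K => IsMinor (kStar k) K)
      (fun _ _ hle h => h.mono hle) (pieceSize k d (ε / 2)) ⌈2 / ε⌉₊ d
    refine ⟨T, ⟨fun G hG => hacc G hG.2, fun G hdeg hfar => hrej G (ε / 2) ?_
      (mul_le_ncard_bad_of_isFar hk hd hε hdeg hfar)⟩, hq⟩
    have h1 := Nat.le_ceil (2 / ε)
    rw [div_le_iff₀ hε.1] at h1
    linarith

theorem starMinorFree_subset_freeProperty (k d : ℕ) (ε : ℝ) (n : ℕ) :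
    (starMinorFree k d).slice n ⊆ (freeProperty d (starFamily k d ε)).slice n :=
  fun _ hG => ⟨hG.1, fun _ _ hH hc => hG.2 (hH.2.of_isContained hc)⟩

theorem starFamily_isBoundedBy (k d : ℕ) (ε : ℝ) :
    (starFamily k d ε).IsBoundedBy ⌊(k : ℝ) / ε + k * d⌋₊ :=
  fun _ _ hH => Nat.le_floor hH.1

end BoundedDegree

theorem mainTheorem11 (k d : ℕ) (hk : 1 ≤ k) (hd : 1 ≤ d) :
    (BoundedDegree.starMinorFree k d).IsMonotone ∧
    (BoundedDegree.starMinorFree k d).IsHereditary ∧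
    (BoundedDegree.starMinorFree k d).IsStronglyTestable ∧
    ∀ ε ∈ Set.Ioo (0 : ℝ) 1,
      (BoundedDegree.starFamily k d ε).IsBoundedBy ⌊(k : ℝ) / ε + k * d⌋₊ ∧
      ∀ n : ℕ,
        (BoundedDegree.starMinorFree k d).slice n ⊆
          (BoundedDegree.freeProperty d (BoundedDegree.starFamily k d ε)).slice n ∧
        BoundedDegree.AreClose d ε
          ((BoundedDegree.freeProperty d (BoundedDegree.starFamily k d ε)).slice n)
          ((BoundedDegree.starMinorFree k d).slice n) ∧
        ∀ G ∈ (BoundedDegree.freeProperty d (BoundedDegree.starFamily k d ε)).slice n,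
          ∃ G' : SimpleGraph (Fin n), G' ≤ G ∧
            ((G.edgeSet \ G'.edgeSet).ncard : ℝ) ≤ ε * d * n ∧
            (∀ c : G'.ConnectedComponent,
              (c.supp.ncard : ℝ) ≤ (k : ℝ) / ε + k * d - k) ∧
            G' ∈ (BoundedDegree.starMinorFree k d).slice n := by
  refine ⟨BoundedDegree.starMinorFree_isMonotone k d,
    BoundedDegree.starMinorFree_isHereditary k d,
    BoundedDegree.starMinorFree_isStronglyTestable hk hd, fun ε hε =>
    ⟨BoundedDegree.starFamily_isBoundedBy k d ε, fun n => ?_⟩⟩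
  have hsub := BoundedDegree.starMinorFree_subset_freeProperty k d ε n
  have hcut := fun G (hG : G ∈ (BoundedDegree.freeProperty d
      (BoundedDegree.starFamily k d ε)).slice n) =>
    BoundedDegree.exists_le_mem_starMinorFree hk hd hε hG.1
      (BoundedDegree.smallBoundary_of_mem_freeProperty hk hd hε hG)
  refine ⟨hsub, ⟨fun G hG => ?_, fun G hG => ⟨G, hsub hG, ?_⟩⟩, fun G hG => ?_⟩
  · obtain ⟨G', hle, hcost, -, hmem⟩ := hcut G hG
    exact ⟨G', hmem, by rwa [BoundedDegree.dist_eq_of_le hle]⟩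
  · have := hε.1
    simp only [BoundedDegree.dist, symmDiff_self, Set.bot_eq_empty, Set.ncard_empty,
      Nat.cast_zero]
    positivity
  · obtain ⟨G', hle, hcost, hc, hmem⟩ := hcut G hG
    exact ⟨G', hle, hcost, fun c => (Nat.cast_le.2 (hc c)).trans
      (BoundedDegree.pieceSize_le hk hd hε), hmem⟩
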